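/- Let $T:M_d(\mathbb C)\to M_d(\mathbb C)$ be an entanglement breaking quantum channel, i.e. a linear map of the form $T(\rho)=\sum_{j=1}^m \mathrm{Tr}(N_j\rho)\,\tau_j$, where $N_1,\dots,N_m\in M_d(\mathbb C)$ are positive semidefinite with $\sum_j N_j=\mathbb 1$ (a POVM) and the $\tau_j\in M_d(\mathbb C)$ are density matrices (positive semidefinite with trace one). Then the limit $$T_\infty=\lim_{N\to\infty}\frac1N\sum_{n=1}^N T^n$$ exists and is a linear projection onto the fixed-point space $\mathcal F_T=\{X\in M_d(\mathbb C): T(X)=X\}$. Moreover, there are density matrices $\sigma_1,\dots,\sigma_k\in M_d(\mathbb C)$ with pairwise orthogonal supports and a POVM $(M_1,\dots,M_k)$ in $M_d(\mathbb C)$ such that $$\mathcal F_T=\mathrm{span}_{\mathbb C}\{\sigma_1,\dots,\sigma_k\},\qquad T_\infty(\rho)=\sum_{i=1}^k \mathrm{Tr}(M_i\rho)\,\sigma_i\ \text{ for all }\rho\in M_d(\mathbb C),\qquad \|M_1\|=\cdots=\|M_k\|=1,$$ where $\|\cdot\|$ is the operator norm. In particular, $T_\infty$ is essentially classical-quantum,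 i.e. it admits a representation of this form by a POVM of norm-one operators and density matrices. -/

import Mathlib

open Filter Topology
open scoped ComplexOrder

/-- Density matrices on `ℂ^d`: positive semidefinite with unit trace. -/
def IsDensityMatrix {d : ℕ} (ρ : Matrix (Fin d) (Fin d) ℂ) : Prop :=
  ρ.PosSemidef ∧ ρ.trace = 1

/-- Positive operator valued measures with finitely many outcomes. -/
def IsPOVM {d k : ℕ} (M : Fin k → Matrix (Fin d) (Fin d) ℂ) : Prop :=
  (∀ i, (M i).PosSemidef) ∧ ∑ i, M i = 1

/-- `T(ρ) = ∑ i, Tr(M i ρ) σ i`, with `(M i)` a POVM and the `σ i` density matrices. -/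
structure IsEntanglementBreakingRep {d n k : ℕ}
    (T : Matrix (Fin d) (Fin d) ℂ →ₗ[ℂ] Matrix (Fin n) (Fin n) ℂ)
    (M : Fin k → Matrix (Fin d) (Fin d) ℂ) (σ : Fin k → Matrix (Fin n) (Fin n) ℂ) : Prop where
  povm : IsPOVM M
  density : ∀ i, IsDensityMatrix (σ i)
  apply_eq : ∀ ρ, T ρ = ∑ i, (M i * ρ).trace • σ i

/-- Entanglement breaking quantum channels: linear maps admitting a representation by
a POVM and density matrices. -/
def IsEntanglementBreaking {d n : ℕ}
    (T : Matrix (Fin d) (Fin d) ℂ →ₗ[ℂ] Matrix (Fin n) (Fin n) ℂ) : Prop :=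
  ∃ (k : ℕ) (M : Fin k → Matrix (Fin d) (Fin d) ℂ) (σ : Fin k → Matrix (Fin n) (Fin n) ℂ),
    IsEntanglementBreakingRep T M σ

/-- A representation witnessing that `T` is essentially classical-quantum: the POVM operators
moreover all have operator norm (for the Euclidean norm on `ℂ^d`) equal to one. -/
structure IsEssentiallyCQRep {d n k : ℕ}
    (T : Matrix (Fin d) (Fin d) ℂ →ₗ[ℂ] Matrix (Fin n) (Fin n) ℂ)
    (M : Fin k → Matrix (Fin d) (Fin d) ℂ) (σ : Fin k → Matrix (Fin n) (Fin n) ℂ) : Prop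
    extends IsEntanglementBreakingRep T M σ where
  norm_eq_one : ∀ i, ‖Matrix.toEuclideanCLM (n := Fin d) (𝕜 := ℂ) (M i)‖ = 1

/-- The support of a Hermitian matrix, as a subspace of the Hilbert space `ℂ^d`: its range,
which is the orthogonal complement of its kernel. -/
noncomputable def matrixSupport {d : ℕ} (A : Matrix (Fin d) (Fin d) ℂ) :
    Submodule ℂ (EuclideanSpace ℂ (Fin d)) :=
  LinearMap.range (Matrix.toEuclideanLin A)

/-- The subspace `{X | T X = X}` of fixed points. -/
def fixedPointSpace {d : ℕ}
    (T : Matrix (Fin d) (Fin d) ℂ →ₗ[ℂ] Matrix (Fin d) (Fin d) ℂ) :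
    Submodule ℂ (Matrix (Fin d) (Fin d) ℂ) :=
  LinearMap.eqLocus T LinearMap.id

/-- The Cesàro mean `(1/N) ∑_{n=1}^N T^n` (with `T^n` the `n`-fold composition). -/
noncomputable def cesaroMean {d : ℕ}
    (T : Matrix (Fin d) (Fin d) ℂ →ₗ[ℂ] Matrix (Fin d) (Fin d) ℂ) (N : ℕ) :
    Matrix (Fin d) (Fin d) ℂ →ₗ[ℂ] Matrix (Fin d) (Fin d) ℂ :=
  (1 / (N : ℂ)) • ∑ n ∈ Finset.Icc 1 N, (T ^ n : Module.End ℂ (Matrix (Fin d) (Fin d) ℂ))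

/-- `S = lim_{N → ∞} (1/N) ∑_{n=1}^N T^n`. Convergence is tested pointwise (entrywise on each
matrix), which on the finite-dimensional space of linear maps is convergence in any norm. -/
def IsCesaroLimit {d : ℕ}
    (T S : Matrix (Fin d) (Fin d) ℂ →ₗ[ℂ] Matrix (Fin d) (Fin d) ℂ) : Prop :=
  ∀ X, Tendsto (fun N : ℕ => cesaroMean T N X) atTop (𝓝 (S X))

/-! Measuring the prepared states gives a stochastic matrix `P l j = Tr(N j * τ l)`, and `T ^ (n +
1)` is: measure, run `P ^ n`, prepare. So the Cesàro means of `T` are governed by those of `P`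
(`cesaroMean_apply`).

The averages of `P ^ n` converge, and each row of the limit is a fixed row vector of `P`. Such
vectors are closed under absolute values, hence spanned by stationary distributions `p i` with
disjoint supports. The limit is therefore `∑ i, h i ⊗ p i` with `h` biorthogonal to `p`.

Put `σ i = ∑ j, p i j • τ j` and `M i = ∑ l, h i l • N l`. Then `Tr(M i * σ j) = δ i j`, and
positivity turns this into `M i * σ i = σ i` and `M i * σ j = 0` for `i ≠ j`: the norms are one and
the supports orthogonal. -/

/-! ### Mean ergodic theorem in finite dimension. -/

theorem exists_isFixedPt_tendsto_birkhoffAverage {E : Type*} [NormedAddCommGroup E]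
    [NormedSpace ℝ E] [FiniteDimensional ℝ E] (f : E →ₗ[ℝ] E) (hf : LipschitzWith 1 f) (x : E) :
    ∃ y, f y = y ∧ Tendsto (birkhoffAverage ℝ f _root_.id · x) atTop (𝓝 y) := by
  have hadd (n : ℕ) (a b : E) : birkhoffAverage ℝ f _root_.id n (a + b) =
      birkhoffAverage ℝ f _root_.id n a + birkhoffAverage ℝ f _root_.id n b := by
    have H : ∀ n x y, f^[n] (x + y) = f^[n] x + f^[n] y := iterate_map_add (f : E →+ E)
    simp [birkhoffAverage, birkhoffSum, Finset.sum_add_distrib, smul_add, H]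
  have hrange (a : E) : Tendsto (birkhoffAverage ℝ f _root_.id · (f a - a)) atTop (𝓝 0) := by
    have hb : Bornology.IsBounded (Set.range (_root_.id <| f^[·] a)) :=
      isBounded_iff_forall_norm_le.2 ⟨‖a‖, Set.forall_mem_range.2 fun n ↦ by
        have H : f^[n] 0 = 0 := iterate_map_zero (f : E →+ E) n
        simpa [H] using (hf.iterate n).dist_le_mul a 0⟩
    have H : ∀ n x y, f^[n] (x - y) = f^[n] x - f^[n] y := iterate_map_sub (f : E →+ E)
    simpa [birkhoffAverage, birkhoffSum, Finset.sum_sub_distrib, smul_sub, H]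
      using tendsto_birkhoffAverage_apply_sub_birkhoffAverage ℝ hb
  have hfix (a : E) (ha : f a = a) : Tendsto (birkhoffAverage ℝ f _root_.id · a) atTop (𝓝 a) :=
    Function.IsFixedPt.tendsto_birkhoffAverage ℝ ha _root_.id
  -- Averages of a vector in both spaces tend to the vector and to `0`; rank-nullity then makes the
  -- two spaces complementary.
  have hdisj : Disjoint (LinearMap.range (f - 1)) (LinearMap.ker (f - 1)) := by
    rw [Submodule.disjoint_def]
    rintro _ ⟨a, rfl⟩ ha
    exact tendsto_nhds_unique (hfix _ (sub_eq_zero.1 (by simpa using ha))) (hrange a)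
  have hcompl := (Submodule.isCompl_iff_disjoint _ _
    (by rw [LinearMap.finrank_range_add_finrank_ker])).2 hdisj
  obtain ⟨_, ⟨a, rfl⟩, z, hz, rfl⟩ :=
    Submodule.mem_sup.1 (hcompl.sup_eq_top ▸ Submodule.mem_top (x := x))
  have hz' : f z = z := sub_eq_zero.1 (by simpa using hz)
  refine ⟨z, hz', ?_⟩
  simp only [hadd]
  simpa using (hrange a).add (hfix z hz')

/-! ### Subspaces closed under absolute values. -/

/-- A subspace of `ι → ℝ` that is closed under absolute values is spanned by nonnegative vectors
with pairwise disjoint supports. -/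
theorem Submodule.exists_disjoint_nonneg_span {ι : Type*} [Fintype ι]
    (V : Submodule ℝ (ι → ℝ)) (hV : ∀ v ∈ V, |v| ∈ V) :
    ∃ (k : ℕ) (p : Fin k → ι → ℝ), (∀ i, 0 ≤ p i) ∧ (∀ i, p i ≠ 0) ∧
      (∀ i i', i ≠ i' → ∀ j, p i j = 0 ∨ p i' j = 0) ∧ V = Submodule.span ℝ (Set.range p) := by
  classical
  let s : (ι → ℝ) → Finset ι := fun v => {j | v j ≠ 0}
  have hs0 (v : ι → ℝ) : s v = ∅ ↔ v = 0 := by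
    simp [s, Finset.filter_eq_empty_iff, funext_iff]
  -- The spanning vectors are indexed by the minimal nonempty supports of elements of `V`.
  let F : Finset (Finset ι) := {S | Minimal (fun S => S.Nonempty ∧ ∃ v ∈ V, s v = S) S}
  have hF (S : F) : ∃ v ∈ V, 0 ≤ v ∧ s v = S := by
    obtain ⟨v, hv, hvS⟩ := (Finset.mem_filter.1 S.2).2.prop.2
    exact ⟨|v|, hV v hv, abs_nonneg v, by rw [← hvS]; ext; simp [s]⟩
  choose p hpV hp0 hps using hF
  have hmin (S : F) (v : ι → ℝ) (hv : v ∈ V) (hv0 : v ≠ 0) (hsub : s v ⊆ S) : s v = S :=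
    (Finset.mem_filter.1 S.2).2.eq_of_le
      ⟨Finset.nonempty_iff_ne_empty.2 (mt (hs0 v).1 hv0), v, hv, rfl⟩ hsub
  have hspan : V = Submodule.span ℝ (Set.range p) := by
    refine le_antisymm ?_ (Submodule.span_le.2 (by rintro _ ⟨S, rfl⟩; exact hpV S))
    suffices h : ∀ (n : ℕ) (v : ι → ℝ), v ∈ V → (s v).card = n →
        v ∈ Submodule.span ℝ (Set.range p) from fun v hv => h _ v hv rfl
    intro n
    induction n using Nat.strong_induction_on with
    | _ n ih =>
      intro v hv hn
      by_cases hv0 : v = 0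
      · simp [hv0]
      obtain ⟨S, hSv, hS⟩ := exists_minimal_le_of_wellFoundedLT
        (fun S => S.Nonempty ∧ ∃ v ∈ V, s v = S) (s v)
        ⟨Finset.nonempty_iff_ne_empty.2 (mt (hs0 v).1 hv0), v, hv, rfl⟩
      let S' : F := ⟨S, by simpa [F] using hS⟩
      obtain ⟨j, hj⟩ := hS.prop.1
      have hpj : p S' j ≠ 0 := by
        have : j ∈ s (p S') := by rw [hps]; exact hj
        simpa [s] using this
      -- The coefficient cancels coordinate `j`, so the support strictly shrinks.
      have hw := V.sub_mem hv (V.smul_mem (v j / p S' j) (hpV S'))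
      have hlt : s (v - (v j / p S' j) • p S') ⊂ s v := by
        refine (Finset.ssubset_iff_of_subset ?_).2 ⟨j, hSv hj, ?_⟩
        · intro l hl
          by_contra hlv
          have h1 : l ∉ s (p S') := by rw [hps]; exact fun h => hlv (hSv h)
          simp only [s, Finset.mem_filter_univ, not_not] at h1 hlv hl
          simp [h1, hlv] at hl
        · simp [s, hpj]
      have := ih _ (hn ▸ Finset.card_lt_card hlt) _ hw rfl
      have h2 := Submodule.add_mem _ this (Submodule.smul_mem _ (v j / p S' j)
        (Submodule.subset_span (Set.mem_range_self S')))
      simpa using h2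
  have hdis (S S' : F) (hne : S ≠ S') (j : ι) : p S j = 0 ∨ p S' j = 0 := by
    by_contra! hcon
    -- The infimum of two overlapping vectors is nonzero and supported in both `S` and `S'`, so
    -- minimality forces `S = S'`.
    have hw : p S ⊓ p S' ∈ V := by
      have : p S ⊓ p S' = (2⁻¹ : ℝ) • (p S + p S' - |p S - p S'|) := by
        ext l
        simp only [Pi.inf_apply, Pi.smul_apply, Pi.sub_apply, Pi.add_apply, Pi.abs_apply,
          smul_eq_mul]
        rw [inf_eq_half_smul_add_sub_abs_sub' ℝ (p S l) (p S' l), smul_eq_mul, abs_sub_comm]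
      rw [this]
      exact V.smul_mem _ (V.sub_mem (V.add_mem (hpV S) (hpV S'))
        (hV _ (V.sub_mem (hpV S) (hpV S'))))
    have hws (l : ι) (hl : l ∈ s (p S ⊓ p S')) : p S l ≠ 0 ∧ p S' l ≠ 0 := by
      simp only [s, Finset.mem_filter_univ, Pi.inf_apply] at hl
      refine ⟨fun h => hl ?_, fun h => hl ?_⟩
      · rw [h]; exact inf_eq_left.2 (hp0 S' l)
      · rw [h]; exact inf_eq_right.2 (hp0 S l)
    have hw0 : p S ⊓ p S' ≠ 0 := fun h => by
      have hz := congrFun h j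
      simp only [Pi.inf_apply, Pi.zero_apply] at hz
      rcases min_choice (p S j) (p S' j) with h' | h'
      · exact hcon.1 (h'.symm.trans hz)
      · exact hcon.2 (h'.symm.trans hz)
    have h1 := hmin S _ hw hw0 (by rw [← hps]; intro l hl; simpa [s] using (hws l hl).1)
    have h2 := hmin S' _ hw hw0 (by rw [← hps]; intro l hl; simpa [s] using (hws l hl).2)
    exact hne (Subtype.ext (h1.symm.trans h2))
  let e := (Fintype.equivFin F).symm
  refine ⟨_, p ∘ e, fun i => hp0 _, fun i h => ?_, fun i i' hii j => hdis _ _ (e.injective.ne hii) j,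
    by rw [hspan, e.surjective.range_comp]⟩
  have := (Finset.mem_filter.1 (e i).2).2.prop.1
  rw [← hps, Finset.nonempty_iff_ne_empty] at this
  exact this ((hs0 _).2 h)

/-! ### Stochastic matrices. -/

-- In the maximal-row-sum norm `P` has norm at most one, so right multiplication by `P` is
-- nonexpansive; the orbit of `1` consists of the powers of `P`.
open Matrix in
open scoped Matrix.Norms.Operator in
theorem Matrix.exists_tendsto_average_pow_of_mem_rowStochastic {ι : Type*} [Fintype ι]
    [DecidableEq ι] {P : Matrix ι ι ℝ} (hP : P ∈ rowStochastic ℝ ι) :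
    ∃ Q : Matrix ι ι ℝ, Q * P = Q ∧
      Tendsto (fun N : ℕ => (N : ℝ)⁻¹ • ∑ n ∈ Finset.range N, P ^ n) atTop (𝓝 Q) := by
  have hnorm : ‖P‖₊ ≤ 1 := by
    rw [linfty_opNNNorm_def]
    refine Finset.sup_le fun i _ => ?_
    rw [← NNReal.coe_le_coe]
    push_cast
    simp only [Real.norm_eq_abs, abs_of_nonneg (hP.1 i _)]
    exact (sum_row_of_mem_rowStochastic hP i).le
  have hlip : LipschitzWith 1 (LinearMap.mulRight ℝ P) := by
    refine LipschitzWith.of_dist_le_mul fun X Y => ?_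
    rw [dist_eq_norm, dist_eq_norm, LinearMap.mulRight_apply, LinearMap.mulRight_apply, ← sub_mul]
    refine (norm_mul_le _ _).trans ?_
    rw [mul_comm]
    gcongr
    exact_mod_cast hnorm
  obtain ⟨Q, hQ, hlim⟩ := exists_isFixedPt_tendsto_birkhoffAverage _ hlip (1 : Matrix ι ι ℝ)
  refine ⟨Q, hQ, hlim.congr fun N => ?_⟩
  have h (n : ℕ) : (LinearMap.mulRight ℝ P)^[n] 1 = P ^ n := by
    induction n with
    | zero => simp
    | succ n ih => rw [Function.iterate_succ_apply', ih, LinearMap.mulRight_apply, pow_succ]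
  simp [birkhoffAverage, birkhoffSum, h]

-- The triangle inequality gives `|v| ≤ |v| ᵥ* P`, and both sides have the same total mass since `P`
-- fixes the constant vector.
open Matrix in
theorem Matrix.abs_vecMul_eq_of_mem_rowStochastic {ι : Type*} [Fintype ι] [DecidableEq ι]
    {P : Matrix ι ι ℝ} (hP : P ∈ rowStochastic ℝ ι) {v : ι → ℝ} (hv : v ᵥ* P = v) :
    |v| ᵥ* P = |v| := by
  have hle (j : ι) : |v| j ≤ (|v| ᵥ* P) j := by
    rw [Pi.abs_apply]
    conv_lhs => rw [← hv]
    simp only [vecMul, dotProduct, Pi.abs_apply]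
    refine (Finset.abs_sum_le_sum_abs _ _).trans (le_of_eq ?_)
    exact Finset.sum_congr rfl fun l _ => by rw [abs_mul, abs_of_nonneg (hP.1 l j)]
  have hsum : ∑ j, |v| j = ∑ j, (|v| ᵥ* P) j := by
    have := dotProduct_mulVec |v| P 1
    rw [hP.2] at this
    simpa [dotProduct_one] using this
  exact funext fun j => ((Finset.sum_eq_sum_iff_of_le fun j _ => hle j).1 hsum j
    (Finset.mem_univ j)).symm

open Matrix in
/-- The averages of the powers of a stochastic matrix converge to `∑ i, h i ⊗ p i`, where the `p i`
are stationary distributions and `h` is a partition of unity biorthogonal to them. -/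
theorem Matrix.exists_average_pow_decomposition {ι : Type*} [Fintype ι] [DecidableEq ι]
    {P : Matrix ι ι ℝ} (hP : P ∈ rowStochastic ℝ ι) :
    ∃ (k : ℕ) (p h : Fin k → ι → ℝ), (∀ i, 0 ≤ p i) ∧ (∀ i, ∑ j, p i j = 1) ∧
      (∀ i, p i ᵥ* P = p i) ∧ (∀ i, 0 ≤ h i) ∧ (∀ l, ∑ i, h i l = 1) ∧
      (∀ i i', p i' ⬝ᵥ h i = if i = i' then 1 else 0) ∧
      ∀ l j, Tendsto (fun N : ℕ => (N : ℝ)⁻¹ * ∑ n ∈ Finset.range N, (P ^ n) l j) atTop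
        (𝓝 (∑ i, h i l * p i j)) := by
  obtain ⟨Q, hQP, hlim⟩ := exists_tendsto_average_pow_of_mem_rowStochastic hP
  have hlim' (l j : ι) : Tendsto (fun N : ℕ => (N : ℝ)⁻¹ * ∑ n ∈ Finset.range N, (P ^ n) l j)
      atTop (𝓝 (Q l j)) := by
    simpa [Matrix.sum_apply] using (tendsto_pi_nhds.1 (tendsto_pi_nhds.1 hlim l) j)
  have hQ0 (l j : ι) : 0 ≤ Q l j := ge_of_tendsto' (hlim' l j) fun N =>
    mul_nonneg (by positivity) (Finset.sum_nonneg fun n _ => (pow_mem hP n).1 l j)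
  have hfix (v : ι → ℝ) (hv : v ᵥ* P = v) : v ᵥ* Q = v := by
    have hpow (n : ℕ) : v ᵥ* P ^ n = v := by
      induction n with
      | zero => simp
      | succ n ih => rw [pow_succ, ← vecMul_vecMul, ih, hv]
    have h1 : Tendsto (fun N : ℕ => v ᵥ* ((N : ℝ)⁻¹ • ∑ n ∈ Finset.range N, P ^ n)) atTop
        (𝓝 (v ᵥ* Q)) :=
      ((continuous_const.matrix_vecMul continuous_id).tendsto Q).comp hlim
    refine tendsto_nhds_unique h1 (tendsto_const_nhds.congr' ?_)
    filter_upwards [eventually_ne_atTop 0] with N hN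
    have hN' : (N : ℝ) ≠ 0 := Nat.cast_ne_zero.2 hN
    rw [vecMul_smul, vecMul_sum]
    simp [hpow, ← Nat.cast_smul_eq_nsmul ℝ, smul_smul, hN']
  have hQ1 (l : ι) : ∑ j, Q l j = 1 := by
    have h1 : Tendsto (fun N : ℕ => ∑ j, (N : ℝ)⁻¹ * ∑ n ∈ Finset.range N, (P ^ n) l j)
        atTop (𝓝 (∑ j, Q l j)) := tendsto_finsetSum _ fun j _ => hlim' l j
    refine tendsto_nhds_unique h1 (tendsto_const_nhds.congr' ?_)
    filter_upwards [eventually_ne_atTop 0] with N hN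
    have hN' : (N : ℝ) ≠ 0 := Nat.cast_ne_zero.2 hN
    rw [← Finset.mul_sum, Finset.sum_comm]
    simp [sum_row_of_mem_rowStochastic (pow_mem hP _), hN']
  let V : Submodule ℝ (ι → ℝ) := LinearMap.eqLocus P.vecMulLinear LinearMap.id
  have hmem (v : ι → ℝ) : v ∈ V ↔ v ᵥ* P = v := by simp [V]
  obtain ⟨k, q, hq0, hqne, hqd, hV⟩ := V.exists_disjoint_nonneg_span fun v hv =>
    (hmem _).2 (abs_vecMul_eq_of_mem_rowStochastic hP ((hmem v).1 hv))
  have hqs (i : Fin k) : 0 < ∑ j, q i j := by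
    obtain ⟨j, hj⟩ := Function.ne_iff.1 (hqne i)
    exact Finset.sum_pos' (fun j _ => hq0 i j)
      ⟨j, Finset.mem_univ j, lt_of_le_of_ne (hq0 i j) hj.symm⟩
  let p : Fin k → ι → ℝ := fun i => (∑ j, q i j)⁻¹ • q i
  have hp0 (i : Fin k) : 0 ≤ p i := smul_nonneg (inv_nonneg.2 (hqs i).le) (hq0 i)
  have hp1 (i : Fin k) : ∑ j, p i j = 1 := by
    simp [p, ← Finset.mul_sum, (hqs i).ne']
  have hpP (i : Fin k) : p i ᵥ* P = p i := (hmem _).1 <|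
    V.smul_mem _ (hV ▸ Submodule.subset_span (Set.mem_range_self i))
  have hrow (l : ι) : ∃ c : Fin k → ℝ, ∀ j, Q l j = ∑ i, c i * p i j := by
    have : Q l ∈ V := (hmem _).2 (by rw [← Matrix.mul_apply_eq_vecMul, hQP])
    rw [hV, Submodule.mem_span_range_iff_exists_fun] at this
    obtain ⟨c, hc⟩ := this
    refine ⟨fun i => c i * ∑ j, q i j, fun j => ?_⟩
    rw [← hc]
    simp only [Finset.sum_apply, Pi.smul_apply, smul_eq_mul, p]
    refine Finset.sum_congr rfl fun i _ => ?_
    have := (hqs i).ne'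
    field_simp
  choose c hc using hrow
  -- A point charged by `p i` alone: evaluating there reads off the `i`-th coefficient.
  have hpos (i : Fin k) : ∃ j, 0 < p i j ∧ ∀ i', i' ≠ i → p i' j = 0 := by
    obtain ⟨j, hj⟩ := Function.ne_iff.1 (hqne i)
    refine ⟨j, mul_pos (inv_pos.2 (hqs i)) (lt_of_le_of_ne (hq0 i j) hj.symm), fun i' hi => ?_⟩
    simp [p, (hqd i' i hi j).resolve_right hj]
  choose J hJ hJ' using hpos
  have hcoef (a : Fin k → ℝ) (i : Fin k) : ∑ i', a i' * p i' (J i) = a i * p i (J i) :=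
    Finset.sum_eq_single i (fun i' _ h => by rw [hJ' i i' h, mul_zero]) (by simp)
  refine ⟨k, p, fun i l => c l i, hp0, hp1, hpP, fun i l => ?_, fun l => ?_, fun i i' => ?_,
    fun l j => hc l j ▸ hlim' l j⟩
  · have := hQ0 l (J i)
    rw [hc, hcoef] at this
    exact nonneg_of_mul_nonneg_left this (hJ i)
  · have := hQ1 l
    simp only [hc] at this
    rw [Finset.sum_comm] at this
    simpa [← Finset.mul_sum, hp1] using this
  -- Biorthogonality is `p i' ᵥ* Q = p i'` read at `J i`.
  · have h1 := congrFun (hfix _ (hpP i')) (J i)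
    have h2 : (p i' ᵥ* Q) (J i) = (∑ l, p i' l * c l i) * p i (J i) := by
      simp only [vecMul, dotProduct, hc, hcoef, Finset.sum_mul, mul_assoc]
    rw [h2] at h1
    simp only [dotProduct]
    split_ifs with h
    · subst h
      exact mul_right_cancel₀ (hJ i).ne' (by rw [h1, one_mul])
    · rw [hJ' i i' (Ne.symm h)] at h1
      exact (mul_eq_zero.1 h1).resolve_right (hJ i).ne'

/-! ### Positive semidefinite matrices and POVMs. -/

namespace Matrix.PosSemidef

variable {n : Type*} [Fintype n] [DecidableEq n] {A B : Matrix n n ℂ}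

-- Writes `Tr(A * B)` as a squared Hilbert–Schmidt norm, which yields both its nonnegativity and the
-- case where it vanishes.
open scoped MatrixOrder in
theorem exists_trace_mul_eq (hA : A.PosSemidef) (hB : B.PosSemidef) :
    ∃ C D : Matrix n n ℂ, A = Cᴴ * C ∧ B = Dᴴ * D ∧
      (A * B).trace = ((C * Dᴴ)ᴴ * (C * Dᴴ)).trace := by
  obtain ⟨C, rfl⟩ := CStarAlgebra.nonneg_iff_eq_star_mul_self.1 hA.nonneg
  obtain ⟨D, rfl⟩ := CStarAlgebra.nonneg_iff_eq_star_mul_self.1 hB.nonneg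
  refine ⟨C, D, rfl, rfl, ?_⟩
  simp only [star_eq_conjTranspose, conjTranspose_mul, conjTranspose_conjTranspose]
  rw [← Matrix.mul_assoc, Matrix.trace_mul_comm]
  simp only [Matrix.mul_assoc]

theorem trace_mul_nonneg (hA : A.PosSemidef) (hB : B.PosSemidef) : 0 ≤ (A * B).trace := by
  obtain ⟨C, D, -, -, h⟩ := hA.exists_trace_mul_eq hB
  exact h ▸ (posSemidef_conjTranspose_mul_self _).trace_nonneg

theorem mul_eq_zero_of_trace_mul_eq_zero (hA : A.PosSemidef) (hB : B.PosSemidef)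
    (h : (A * B).trace = 0) : A * B = 0 := by
  obtain ⟨C, D, hC, hD, h'⟩ := hA.exists_trace_mul_eq hB
  have h0 : C * Dᴴ = 0 := trace_conjTranspose_mul_self_eq_zero_iff.1 (h'.symm.trans h)
  rw [hC, hD, Matrix.mul_assoc, ← Matrix.mul_assoc C, h0, Matrix.zero_mul, Matrix.mul_zero]

open scoped MatrixOrder Matrix.Norms.L2Operator in
theorem norm_toEuclideanCLM_le_one (hA : A.PosSemidef) (hA1 : (1 - A).PosSemidef) :
    ‖Matrix.toEuclideanCLM (n := n) (𝕜 := ℂ) A‖ ≤ 1 := by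
  rw [l2_opNorm_toEuclideanCLM]
  exact (CStarAlgebra.norm_le_one_iff_of_nonneg A hA.nonneg).2 hA1

end Matrix.PosSemidef

theorem matrixSupport_isOrtho_of_mul_eq_zero {d : ℕ} {A B : Matrix (Fin d) (Fin d) ℂ}
    (hA : A.IsHermitian) (h : A * B = 0) : matrixSupport A ⟂ matrixSupport B := by
  rw [Submodule.isOrtho_iff_inner_eq]
  rintro _ ⟨x, rfl⟩ _ ⟨y, rfl⟩
  rw [← LinearMap.adjoint_inner_right, ← Matrix.toEuclideanLin_conjTranspose_eq_adjoint, hA.eq]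
  have : Matrix.toEuclideanLin A (Matrix.toEuclideanLin B y) = 0 := by
    simp [Matrix.toLpLin_apply, h]
  rw [this, inner_zero_right]

namespace IsPOVM

variable {d k : ℕ} {M : Fin k → Matrix (Fin d) (Fin d) ℂ}

theorem one_sub_posSemidef (hM : IsPOVM M) (i : Fin k) : (1 - M i).PosSemidef := by
  rw [← hM.2, ← Finset.add_sum_erase _ _ (Finset.mem_univ i), add_sub_cancel_left]
  exact Matrix.posSemidef_sum _ fun j _ => hM.1 j

/-- Here `1 - M i` and `σ` are positive with `Tr((1 - M i) * σ) = 0`, so their product vanishes. -/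
theorem mul_eq_right (hM : IsPOVM M) {i : Fin k} {σ : Matrix (Fin d) (Fin d) ℂ}
    (hσ : IsDensityMatrix σ) (h : (M i * σ).trace = 1) : M i * σ = σ := by
  have := (hM.one_sub_posSemidef i).mul_eq_zero_of_trace_mul_eq_zero hσ.1
    (by rw [sub_mul, one_mul, Matrix.trace_sub, hσ.2, h, sub_self])
  rw [sub_mul, one_mul, sub_eq_zero] at this
  exact this.symm

theorem norm_eq_one (hM : IsPOVM M) {i : Fin k} {σ : Matrix (Fin d) (Fin d) ℂ}
    (hσ : IsDensityMatrix σ) (h : (M i * σ).trace = 1) :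
    ‖Matrix.toEuclideanCLM (n := Fin d) (𝕜 := ℂ) (M i)‖ = 1 := by
  refine le_antisymm ((hM.1 i).norm_toEuclideanCLM_le_one (hM.one_sub_posSemidef i)) ?_
  have hσ0 : Matrix.toEuclideanCLM (n := Fin d) (𝕜 := ℂ) σ ≠ 0 := fun h0 => by
    have : σ = 0 := by simpa using h0
    have h1 := hσ.2
    simp [this] at h1
  have hle := norm_mul_le (Matrix.toEuclideanCLM (n := Fin d) (𝕜 := ℂ) (M i))
    (Matrix.toEuclideanCLM (n := Fin d) (𝕜 := ℂ) σ)
  rw [← map_mul, hM.mul_eq_right hσ h] at hle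
  exact (le_mul_iff_one_le_left (norm_pos_iff.2 hσ0)).1 hle

end IsPOVM

/-! ### From the channel to the Markov chain and back. -/

/-- The classical channel `τ l ↦ outcome j` obtained by measuring the prepared states. -/
noncomputable def transitionMatrix {d m : ℕ}
    (N τ : Fin m → Matrix (Fin d) (Fin d) ℂ) : Matrix (Fin m) (Fin m) ℝ :=
  Matrix.of fun l j => (N j * τ l).trace.re

namespace IsEntanglementBreakingRep

variable {d m : ℕ} {T : Matrix (Fin d) (Fin d) ℂ →ₗ[ℂ] Matrix (Fin d) (Fin d) ℂ}
  {N τ : Fin m → Matrix (Fin d) (Fin d) ℂ}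

theorem ofReal_transitionMatrix (h : IsEntanglementBreakingRep T N τ) (l j : Fin m) :
    (transitionMatrix N τ l j : ℂ) = (N j * τ l).trace := by
  have := (Complex.nonneg_iff.1 ((h.povm.1 j).trace_mul_nonneg (h.density l).1)).2
  exact Complex.ext rfl (by simpa using this)

theorem transitionMatrix_mem_rowStochastic (h : IsEntanglementBreakingRep T N τ) :
    transitionMatrix N τ ∈ Matrix.rowStochastic ℝ (Fin m) := by
  refine Matrix.mem_rowStochastic_iff_sum.2 ⟨fun l j => ?_, fun l => ?_⟩
  · exact (Complex.nonneg_iff.1 ((h.povm.1 j).trace_mul_nonneg (h.density l).1)).1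
  · apply Complex.ofReal_injective
    push_cast
    simp only [h.ofReal_transitionMatrix]
    rw [← Matrix.trace_sum, ← Finset.sum_mul, h.povm.2, one_mul, (h.density l).2]

/-- Preparation intertwines `P` acting on row vectors with `T`. -/
theorem apply_sum_smul (h : IsEntanglementBreakingRep T N τ) (p : Fin m → ℝ) :
    T (∑ l, (p l : ℂ) • τ l) =
      ∑ j, ((Matrix.vecMul p (transitionMatrix N τ) j : ℝ) : ℂ) • τ j := by
  rw [map_sum]
  simp only [map_smul]
  simp only [h.apply_eq, Matrix.vecMul, dotProduct, Complex.ofReal_sum,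
    Complex.ofReal_mul, h.ofReal_transitionMatrix, Finset.smul_sum, Finset.sum_smul, smul_smul]
  exact Finset.sum_comm

theorem pow_apply (h : IsEntanglementBreakingRep T N τ) (n : ℕ) (l : Fin m) :
    (T ^ n : Module.End ℂ _) (τ l) = ∑ j, (((transitionMatrix N τ ^ n) l j : ℝ) : ℂ) • τ j := by
  induction n with
  | zero => simp [Matrix.one_apply, Finset.sum_ite_eq]
  | succ n ih =>
    rw [pow_succ', Module.End.mul_apply, ih, h.apply_sum_smul]
    simp only [pow_succ, Matrix.mul_apply_eq_vecMul]

theorem cesaroMean_apply (h : IsEntanglementBreakingRep T N τ) (K : ℕ)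
    (X : Matrix (Fin d) (Fin d) ℂ) :
    cesaroMean T K X = ∑ l, (N l * X).trace • ∑ j,
      (((K : ℝ)⁻¹ * ∑ n ∈ Finset.range K, (transitionMatrix N τ ^ n) l j : ℝ) : ℂ) • τ j := by
  have hIcc : Finset.Icc 1 K = (Finset.range K).image (· + 1) := by
    ext a
    simp only [Finset.mem_Icc, Finset.mem_image, Finset.mem_range]
    exact ⟨fun ha => ⟨a - 1, by omega, by omega⟩, by rintro ⟨b, hb, rfl⟩; omega⟩
  -- The first application of `T` only measures `X` and prepares, hence the shift from `T ^ (n + 1)`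
  -- to `P ^ n`.
  have hpow (n : ℕ) : (T ^ (n + 1) : Module.End ℂ _) X =
      ∑ l, (N l * X).trace • ∑ j, (((transitionMatrix N τ ^ n) l j : ℝ) : ℂ) • τ j := by
    rw [pow_succ, Module.End.mul_apply, h.apply_eq]
    simp only [map_sum, map_smul, h.pow_apply]
  rw [cesaroMean, hIcc, Finset.sum_image (by simp)]
  simp only [LinearMap.smul_apply, LinearMap.sum_apply, hpow]
  rw [Finset.sum_comm, Finset.smul_sum]
  refine Finset.sum_congr rfl fun l _ => ?_
  rw [← Finset.smul_sum, smul_comm, Finset.sum_comm, Finset.smul_sum]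
  congr 1
  refine Finset.sum_congr rfl fun j _ => ?_
  rw [← Finset.sum_smul, smul_smul]
  push_cast
  rw [one_div]

end IsEntanglementBreakingRep

theorem isDensityMatrix_sum_smul {d m : ℕ} {τ : Fin m → Matrix (Fin d) (Fin d) ℂ}
    (hτ : ∀ j, IsDensityMatrix (τ j)) {p : Fin m → ℝ} (hp : 0 ≤ p) (hp1 : ∑ j, p j = 1) :
    IsDensityMatrix (∑ j, (p j : ℂ) • τ j) := by
  refine ⟨Matrix.posSemidef_sum _ fun j _ => (hτ j).1.smul (by exact_mod_cast hp j), ?_⟩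
  rw [Matrix.trace_sum]
  simp only [Matrix.trace_smul, (hτ _).2, smul_eq_mul, mul_one]
  exact_mod_cast hp1

theorem IsPOVM.sum_smul {d m k : ℕ} {N : Fin m → Matrix (Fin d) (Fin d) ℂ} (hN : IsPOVM N)
    {h : Fin k → Fin m → ℝ} (hh : ∀ i, 0 ≤ h i) (hh1 : ∀ l, ∑ i, h i l = 1) :
    IsPOVM fun i => ∑ l, (h i l : ℂ) • N l := by
  refine ⟨fun i => Matrix.posSemidef_sum _ fun l _ => (hN.1 l).smul (by exact_mod_cast hh i l), ?_⟩
  rw [Finset.sum_comm]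
  simp only [← Finset.sum_smul, ← Complex.ofReal_sum, hh1, Complex.ofReal_one, one_smul]
  exact hN.2

/-- The map `ρ ↦ ∑ i, Tr(M i ρ) σ i`. -/
noncomputable def measurePrepare {d k : ℕ} (M σ : Fin k → Matrix (Fin d) (Fin d) ℂ) :
    Matrix (Fin d) (Fin d) ℂ →ₗ[ℂ] Matrix (Fin d) (Fin d) ℂ :=
  ∑ i, ((Matrix.traceLinearMap (Fin d) ℂ ℂ).comp (LinearMap.mulLeft ℂ (M i))).smulRight (σ i)

theorem measurePrepare_apply {d k : ℕ} (M σ : Fin k → Matrix (Fin d) (Fin d) ℂ)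
    (X : Matrix (Fin d) (Fin d) ℂ) : measurePrepare M σ X = ∑ i, (M i * X).trace • σ i := by
  simp [measurePrepare, LinearMap.sum_apply]

theorem IsCesaroLimit.apply_of_fixed {d : ℕ}
    {T S : Matrix (Fin d) (Fin d) ℂ →ₗ[ℂ] Matrix (Fin d) (Fin d) ℂ} (h : IsCesaroLimit T S)
    {X : Matrix (Fin d) (Fin d) ℂ} (hX : T X = X) : S X = X := by
  refine tendsto_nhds_unique (h X) (tendsto_const_nhds.congr' ?_)
  filter_upwards [eventually_ne_atTop 0] with K hK
  have hK' : (K : ℂ) ≠ 0 := Nat.cast_ne_zero.2 hK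
  have hpow (n : ℕ) : (T ^ n : Module.End ℂ _) X = X := by
    induction n with
    | zero => simp
    | succ n ih => rw [pow_succ, Module.End.mul_apply, hX, ih]
  simp [cesaroMean, LinearMap.sum_apply, hpow, ← Nat.cast_smul_eq_nsmul ℂ, smul_smul, hK']

theorem mainTheorem4 {d : ℕ}
    (T : Matrix (Fin d) (Fin d) ℂ →ₗ[ℂ] Matrix (Fin d) (Fin d) ℂ)
    (hT : IsEntanglementBreaking T) :
    ∃ Tinf : Matrix (Fin d) (Fin d) ℂ →ₗ[ℂ] Matrix (Fin d) (Fin d) ℂ,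
      IsCesaroLimit T Tinf ∧
      LinearMap.IsProj (fixedPointSpace T) Tinf ∧
      ∃ (k : ℕ) (σ : Fin k → Matrix (Fin d) (Fin d) ℂ) (M : Fin k → Matrix (Fin d) (Fin d) ℂ),
        (∀ i, IsDensityMatrix (σ i)) ∧
        (∀ i j, i ≠ j → matrixSupport (σ i) ⟂ matrixSupport (σ j)) ∧
        fixedPointSpace T = Submodule.span ℂ (Set.range σ) ∧
        IsEssentiallyCQRep Tinf M σ := by
  obtain ⟨m, N, τ, hrep⟩ := hT
  obtain ⟨k, p, h, hp0, hp1, hpP, hh0, hh1, hph, hlim⟩ :=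
    Matrix.exists_average_pow_decomposition hrep.transitionMatrix_mem_rowStochastic
  let σ : Fin k → Matrix (Fin d) (Fin d) ℂ := fun i => ∑ j, (p i j : ℂ) • τ j
  let M : Fin k → Matrix (Fin d) (Fin d) ℂ := fun i => ∑ l, (h i l : ℂ) • N l
  have hσ (i : Fin k) : IsDensityMatrix (σ i) :=
    isDensityMatrix_sum_smul hrep.density (hp0 i) (hp1 i)
  have hM : IsPOVM M := hrep.povm.sum_smul hh0 hh1
  have hTσ (i : Fin k) : T (σ i) = σ i := by simp only [σ, hrep.apply_sum_smul, hpP]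
  have htr (i i' : Fin k) : (M i * σ i').trace = if i = i' then 1 else 0 := by
    -- The pairing brings in one extra transition step, which stationarity of `p i'` absorbs.
    have h1 : (M i * σ i').trace =
        ((Matrix.vecMul (p i') (transitionMatrix N τ) ⬝ᵥ h i : ℝ) : ℂ) := by
      simp only [M, σ, Finset.sum_mul, Finset.mul_sum, Matrix.trace_sum, smul_mul_assoc,
        mul_smul_comm, Matrix.trace_smul, smul_eq_mul, Matrix.vecMul, dotProduct,
        Complex.ofReal_sum, Complex.ofReal_mul, hrep.ofReal_transitionMatrix]
      rw [Finset.sum_comm]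
      refine Finset.sum_congr rfl fun l _ => Finset.sum_congr rfl fun j _ => ?_
      ring
    rw [h1, hpP, hph]
    split_ifs <;> simp
  have hces : IsCesaroLimit T (measurePrepare M σ) := fun X => by
    have hval : measurePrepare M σ X = ∑ l, (N l * X).trace • ∑ j,
        ((∑ i, h i l * p i j : ℝ) : ℂ) • τ j := by
      simp only [measurePrepare_apply, M, σ, Finset.sum_mul, Matrix.trace_sum, smul_mul_assoc,
        Matrix.trace_smul, Finset.sum_smul, Finset.smul_sum, smul_smul, smul_eq_mul,
        Complex.ofReal_sum, Complex.ofReal_mul]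
      rw [Finset.sum_comm]
      conv_rhs => rw [Finset.sum_comm]
      refine Finset.sum_congr rfl fun j _ => ?_
      rw [Finset.sum_comm]
      refine Finset.sum_congr rfl fun l _ => ?_
      refine Finset.sum_congr rfl fun i _ => ?_
      congr 1
      ring
    rw [hval]
    simp only [hrep.cesaroMean_apply]
    exact tendsto_finsetSum _ fun l _ => Tendsto.const_smul (tendsto_finsetSum _ fun j _ =>
      Tendsto.smul_const ((Complex.continuous_ofReal.tendsto _).comp (hlim l j)) _) _
  have hmem (X : Matrix (Fin d) (Fin d) ℂ) : X ∈ fixedPointSpace T ↔ T X = X := Iff.rfl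
  have hspan (X : Matrix (Fin d) (Fin d) ℂ) :
      measurePrepare M σ X ∈ Submodule.span ℂ (Set.range σ) := by
    rw [measurePrepare_apply]
    exact Submodule.sum_mem _ fun i _ =>
      Submodule.smul_mem _ _ (Submodule.subset_span (Set.mem_range_self i))
  have hle : Submodule.span ℂ (Set.range σ) ≤ fixedPointSpace T :=
    Submodule.span_le.2 (by rintro _ ⟨i, rfl⟩; exact hTσ i)
  refine ⟨measurePrepare M σ, hces,
    ⟨fun X => hle (hspan X), fun X hX => hces.apply_of_fixed hX⟩, k, σ, M, hσ,
    fun i j hij => ?_, le_antisymm (fun X hX => ?_) hle,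
    ⟨⟨hM, hσ, measurePrepare_apply M σ⟩, fun i => hM.norm_eq_one (hσ i) (by simp [htr])⟩⟩
  · refine matrixSupport_isOrtho_of_mul_eq_zero (hσ i).1.isHermitian ?_
    -- With this, `σ i * σ j = σ i * (M i * σ j) = 0`.
    have h1 : σ i * M i = σ i := by
      have := congrArg Matrix.conjTranspose (hM.mul_eq_right (hσ i) (i := i) (by simp [htr]))
      rwa [Matrix.conjTranspose_mul, (hσ i).1.isHermitian.eq, (hM.1 i).isHermitian.eq] at this
    have h2 : M i * σ j = 0 :=
      (hM.1 i).mul_eq_zero_of_trace_mul_eq_zero (hσ j).1 (by simp [htr, hij])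
    rw [← h1, Matrix.mul_assoc, h2, Matrix.mul_zero]
  · rw [← hces.apply_of_fixed hX]
    exact hspan X
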